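/- Let $\mathcal H\neq 0$ and $\mathcal H'$ be finite-dimensional complex Hilbert spaces and let $\mathcal E:\mathcal B(\mathcal H)\to\mathcal B(\mathcal H')$ be a completely positive trace-preserving (CPTP) linear map. Let $\|A\|_1=\operatorname{tr}\sqrt{A^\dagger A}$. A code is an arbitrary set $\mathcal C$ of density operators on $\mathcal H$; write $\operatorname{conv}\mathcal C$ for its convex hull. A code $\mathcal C$ is preserved by $\mathcal E$ (the Weak, or isometry, condition) if $$\|\mathcal E(p\rho-(1-p)\sigma)\|_1=\|p\rho-(1-p)\sigma\|_1\qquad\text{for all }\rho,\sigma\in\operatorname{conv}\mathcal C,\ p\in[0,1].$$ Two codes $\mathcal C_1,\mathcal C_2$ are isometric if there is a linear map $f$ that restricts to a bijection $\mathcal C_1\to\mathcal C_2$ and satisfies $\|pf(\rho)-(1-p)f(\sigma)\|_1=\|p\rho-(1-p)\sigma\|_1$ for all $\rho,\sigma\in\operatorname{conv}\mathcal C_1$ and $p\in[0,1]$. A preserved code $\mathcal C$ is maximum if there is no preserved code $\mathcal C_{\mathrm{big}}$ such that $\mathcal C$ is isometric to a strict subset of $\mathcal C_{\mathrm{big}}$.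 A code $\mathcal C$ is fixed by a CPTP map $\Phi$ (the Strong condition) if $\Phi(\rho)=\rho$ for all $\rho\in\mathcal C$. Then: 1. For every maximum preserved code $\mathcal C$ of $\mathcal E$ there is a CPTP map $\mathcal R:\mathcal B(\mathcal H')\to\mathcal B(\mathcal H)$ such that $\mathcal R\circ\mathcal E(\rho)=\rho$ for all $\rho\in\mathcal C$. 2. Conversely, if $\mathcal C$ is any code for which there is a CPTP map $\mathcal R:\mathcal B(\mathcal H')\to\mathcal B(\mathcal H)$ such that $\mathcal R\circ\mathcal E$ fixes $\mathcal C$, then $\mathcal C$ is preserved by $\mathcal E$. In particular, once a recovery is allowed, the Weak and the Strong conditions agree in this sense. -/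

import Mathlib

noncomputable section

namespace QuantumCode

open scoped Matrix MatrixOrder ComplexOrder

variable {n m : Type*} [Fintype n] [DecidableEq n] [Fintype m] [DecidableEq m]

/-- The trace norm (1-norm) `‖A‖₁ = tr |A| = tr √(Aᴴ A)` of a complex square matrix. -/
def traceNorm (A : Matrix n n ℂ) : ℝ := (CFC.sqrt (Aᴴ * A)).trace.re

/-- The state space: the density matrices, i.e. positive semidefinite matrices of trace one. -/
def stateSpace (n : Type*) [Fintype n] : Set (Matrix n n ℂ) :=
  {ρ | ρ.PosSemidef ∧ ρ.trace = 1}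

/-- Complete positivity: for every `k`, the map `id ⊗ Φ` on `k × k` block matrices, which applies
`Φ` to each block, sends positive semidefinite matrices to positive semidefinite matrices.
(`Matrix.comp` reads a block matrix as an ordinary matrix.) -/
def IsCompletelyPositive (Φ : Matrix n n ℂ →ₗ[ℂ] Matrix m m ℂ) : Prop :=
  ∀ (k : ℕ) (X : Matrix (Fin k) (Fin k) (Matrix n n ℂ)),
    (Matrix.comp (Fin k) (Fin k) n n ℂ X).PosSemidef →
      (Matrix.comp (Fin k) (Fin k) m m ℂ (X.map Φ)).PosSemidef

/-- CPTP: completely positive and trace preserving. -/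
structure IsCPTP (Φ : Matrix n n ℂ →ₗ[ℂ] Matrix m m ℂ) : Prop where
  completelyPositive : IsCompletelyPositive Φ
  trace_map : ∀ X : Matrix n n ℂ, (Φ X).trace = X.trace

/-- Two codes are isometric if some linear bijection between them preserves all weighted 1-norm
distances on the convex hull of the first. (A linear map on the span of a code always extends to
the whole matrix space.) -/
def IsIsometric (C₁ : Set (Matrix n n ℂ)) (C₂ : Set (Matrix m m ℂ)) : Prop :=
  ∃ f : Matrix n n ℂ →ₗ[ℝ] Matrix m m ℂ, Set.BijOn f C₁ C₂ ∧
    ∀ ρ ∈ convexHull ℝ C₁, ∀ σ ∈ convexHull ℝ C₁, ∀ p ∈ Set.Icc (0 : ℝ) 1,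
      traceNorm (p • f ρ - (1 - p) • f σ) = traceNorm (p • ρ - (1 - p) • σ)

/-- `C` is a code (a set of states) which is preserved by `E`, i.e. satisfies the Weak Condition:
`E` preserves all weighted 1-norm distances on the convex hull of `C`. -/
def IsPreserved (E : Matrix n n ℂ →ₗ[ℂ] Matrix m m ℂ) (C : Set (Matrix n n ℂ)) : Prop :=
  C ⊆ stateSpace n ∧
    ∀ ρ ∈ convexHull ℝ C, ∀ σ ∈ convexHull ℝ C, ∀ p ∈ Set.Icc (0 : ℝ) 1,
      traceNorm (E (p • ρ - (1 - p) • σ)) = traceNorm (p • ρ - (1 - p) • σ)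

/-- A preserved code is maximum if it is not isometric to a strict subset of a preserved code. -/
def IsMaximumPreserved (E : Matrix n n ℂ →ₗ[ℂ] Matrix m m ℂ) (C : Set (Matrix n n ℂ)) : Prop :=
  IsPreserved E C ∧
    ¬ ∃ Cbig Csmall : Set (Matrix n n ℂ), IsPreserved E Cbig ∧ Csmall ⊂ Cbig ∧ IsIsometric C Csmall

/-- The Strong Condition: `C` is fixed by `Φ` if `Φ` leaves every state of `C` unchanged. -/
def IsFixed (Φ : Matrix n n ℂ →ₗ[ℂ] Matrix n n ℂ) (C : Set (Matrix n n ℂ)) : Prop :=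
  ∀ ρ ∈ C, Φ ρ = ρ

end QuantumCode

end

/-!
Write the channel as `E X = ∑ i, K i * X * (K i)ᴴ`. For a Hermitian matrix `X` with support
projection `P`, the equality `‖E X‖₁ = ‖X‖₁` says that `E X⁺` and `E X⁻` are orthogonal, that is,
`X⁺ * (K i)ᴴ * K j * X⁻ = 0` for all `i` and `j`; then the sign of `X` commutes with all the
products `P * (K i)ᴴ * K j * P`. These products and `P` have a commutant `A`. Since
`‖X‖₁ = tr (sign X * X)`, the trace-preserving conditional expectation `e` onto `A` keeps the norm
of `X`. A preserved code `C` contains, up to convex combinations, a state of maximal support `P`,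
and a small multiple of it moves any element of the real span of `C` to one with support `P`, so
`e` is isometric on this span.

All states in `A` supported on `P` form a preserved code that contains `e(C)`; if `C` is maximum,
the two are equal. Hence `P` and each of its subprojections in `A` are images of positive elements
of the span. With `e D = P`, positivity forces `X = D * e X` with commuting factors for every `X`
in the span. Each state of `C` thus has the form `√D * a * √D` with `a` in `A`, and the Petz map of
the Kraus operators `K i * √D` recovers it.

Conversely, a channel with a left inverse on `C` preserves trace norms there, because channels
never increase them.
-/

noncomputable section

namespace QuantumCode

open scoped Matrix MatrixOrder ComplexOrder Kronecker

section FunctionalCalculus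

lemma mul_eq_self_of_mul_eq_self {R : Type*} [Mul R] [StarMul R] {x p : R}
    (hx : IsSelfAdjoint x) (hp : IsSelfAdjoint p) (h : x * p = x) : p * x = x := by
  simpa only [star_mul, hx.star_eq, hp.star_eq] using congrArg star h

variable {n : Type*} [Fintype n] [DecidableEq n]

lemma continuousOn_spectrum (f : ℝ → ℝ) (X : Matrix n n ℂ) : ContinuousOn f (spectrum ℝ X) :=
  (Matrix.finite_real_spectrum (A := X)).continuousOn f

lemma cfc_mul_cfc (f g : ℝ → ℝ) (X : Matrix n n ℂ) :
    cfc f X * cfc g X = cfc (fun x => f x * g x) X :=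
  (cfc_mul f g X (continuousOn_spectrum f X) (continuousOn_spectrum g X)).symm

lemma cfc_add_cfc (f g : ℝ → ℝ) (X : Matrix n n ℂ) :
    cfc f X + cfc g X = cfc (fun x => f x + g x) X :=
  (cfc_add X f g (continuousOn_spectrum f X) (continuousOn_spectrum g X)).symm

lemma cfc_sub_cfc (f g : ℝ → ℝ) (X : Matrix n n ℂ) :
    cfc f X - cfc g X = cfc (fun x => f x - g x) X :=
  (cfc_sub f g X (continuousOn_spectrum f X) (continuousOn_spectrum g X)).symm

lemma isHermitian_cfc (f : ℝ → ℝ) (X : Matrix n n ℂ) : (cfc f X).IsHermitian :=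
  cfc_predicate (p := IsSelfAdjoint) f X

lemma cfc_mul_self {X : Matrix n n ℂ} (hX : X.IsHermitian) (f : ℝ → ℝ) :
    cfc f X * X = cfc (fun x => f x * x) X := by
  simpa only [cfc_id' ℝ X hX.isSelfAdjoint] using cfc_mul_cfc f (fun x => x) X

lemma cfc_mul_eq_zero {f : ℝ → ℝ} (hf : f 0 = 0) {X Z : Matrix n n ℂ} (hX : X.IsHermitian)
    (h : X * Z = 0) : cfc f X * Z = 0 := by
  have hfactor : cfc f X = cfc (fun x => f x / x) X * X := by
    rw [cfc_mul_self hX]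
    refine congrArg (cfc · X) (funext fun x => ?_)
    rcases eq_or_ne x 0 with rfl | hx
    · simp [hf]
    · field_simp
  rw [hfactor, mul_assoc, h, mul_zero]

lemma cfc_mul_eq_self {f : ℝ → ℝ} (hf : f 0 = 0) {X P : Matrix n n ℂ} (hX : X.IsHermitian)
    (h : X * P = X) : cfc f X * P = cfc f X := by
  have := cfc_mul_eq_zero hf hX (Z := P - 1) (by rw [mul_sub, h, mul_one, sub_self])
  rwa [mul_sub, mul_one, sub_eq_zero] at this

lemma posPart_eq_cfc (X : Matrix n n ℂ) : X⁺ = cfc (fun x : ℝ => x⁺) X :=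
  cfcₙ_eq_cfc (by fun_prop) (by simp)

lemma negPart_eq_cfc (X : Matrix n n ℂ) : X⁻ = cfc (fun x : ℝ => x⁻) X :=
  cfcₙ_eq_cfc (by fun_prop) (by simp)

/-- The spectral projection of a Hermitian matrix belonging to a set of real numbers. -/
def spectralProj (s : Set ℝ) (X : Matrix n n ℂ) : Matrix n n ℂ := cfc (s.indicator 1) X

/-- The support projection of a Hermitian matrix: the projection onto its range. -/
def supportProj (X : Matrix n n ℂ) : Matrix n n ℂ := spectralProj {0}ᶜ X

/-- The sign `P₊ - P₋` of a Hermitian matrix, the difference of the projections onto the supports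
of its positive and negative parts. -/
def signOp (X : Matrix n n ℂ) : Matrix n n ℂ := cfc Real.sign X

lemma isStarProjection_spectralProj (s : Set ℝ) (X : Matrix n n ℂ) :
    IsStarProjection (spectralProj s X) where
  isSelfAdjoint := isHermitian_cfc _ X
  isIdempotentElem := by
    rw [IsIdempotentElem, spectralProj, cfc_mul_cfc]
    refine congrArg (cfc · X) (funext fun x => ?_)
    by_cases hx : x ∈ s <;> simp [hx]

lemma isStarProjection_supportProj (X : Matrix n n ℂ) : IsStarProjection (supportProj X) :=
  isStarProjection_spectralProj _ X

lemma isHermitian_signOp (X : Matrix n n ℂ) : (signOp X).IsHermitian :=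
  isHermitian_cfc _ X

lemma mul_supportProj {X : Matrix n n ℂ} (hX : X.IsHermitian) : X * supportProj X = X := by
  rw [supportProj, spectralProj, (Commute.cfc_real (Commute.refl X) _).symm.eq, cfc_mul_self hX]
  conv_rhs => rw [← cfc_id' ℝ X hX.isSelfAdjoint]
  refine congrArg (cfc · X) (funext fun x => ?_)
  rcases eq_or_ne x 0 with rfl | hx <;> simp [*]

lemma supportProj_mul_eq_self {X P : Matrix n n ℂ} (hX : X.IsHermitian) (h : X * P = X) :
    supportProj X * P = supportProj X :=
  cfc_mul_eq_self (by simp) hX h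

lemma signOp_mul_supportProj {X : Matrix n n ℂ} (hX : X.IsHermitian) :
    signOp X * supportProj X = signOp X :=
  cfc_mul_eq_self Real.sign_zero hX (mul_supportProj hX)

lemma supportProj_mul_signOp {X : Matrix n n ℂ} (hX : X.IsHermitian) :
    supportProj X * signOp X = signOp X :=
  (cfc_commute_cfc _ _ X).eq.trans (signOp_mul_supportProj hX)

lemma signOp_mul_self {X : Matrix n n ℂ} (hX : X.IsHermitian) : signOp X * X = CFC.abs X := by
  rw [signOp, cfc_mul_self hX, CFC.abs_eq_cfc_norm X hX.isSelfAdjoint]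
  refine congrArg (cfc · X) (funext fun x => ?_)
  rcases lt_trichotomy x 0 with hx | rfl | hx
  · simp [Real.sign_of_neg hx, abs_of_neg hx]
  · simp
  · simp [Real.sign_of_pos hx, abs_of_pos hx]

lemma mem_of_forall_spectralProj_mem {X : Matrix n n ℂ} (hX : X.IsHermitian)
    {S : Submodule ℝ (Matrix n n ℂ)} (h : ∀ x ≠ 0, spectralProj {x} X ∈ S) : X ∈ S := by
  have hsum : X = ∑ x ∈ (Matrix.finite_real_spectrum (A := X)).toFinset,
      x • spectralProj {x} X := by
    have hsmul : ∀ x : ℝ, x • spectralProj {x} X =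
        cfc (fun y => x * Set.indicator {x} 1 y) X := fun x =>
      (cfc_const_mul x _ X (continuousOn_spectrum _ X)).symm
    simp only [hsmul]
    rw [← cfc_sum _ _ _ fun _ _ => continuousOn_spectrum _ X]
    conv_lhs => rw [← cfc_id' ℝ X hX.isSelfAdjoint]
    refine cfc_congr fun y hy => ?_
    rw [Finset.sum_apply, Finset.sum_eq_single_of_mem y (by simpa using hy)]
    · simp
    · intro x _ hx
      simp [hx.symm]
  rw [hsum]
  refine sum_mem fun x _ => ?_
  rcases eq_or_ne x 0 with rfl | hx
  · simp
  · exact S.smul_mem x (h x hx)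

lemma signOp_le_one (X : Matrix n n ℂ) : signOp X ≤ 1 :=
  cfc_le_one _ _ fun x _ => by rcases Real.sign_apply_eq x with h | h | h <;> simp [h]

lemma neg_one_le_signOp {X : Matrix n n ℂ} (hX : X.IsHermitian) : -1 ≤ signOp X := by
  have h : algebraMap ℝ (Matrix n n ℂ) (-1) ≤ signOp X :=
    algebraMap_le_cfc Real.sign (-1) X
      (fun x _ => by rcases Real.sign_apply_eq x with h | h | h <;> simp [h])
      (continuousOn_spectrum _ X) hX.isSelfAdjoint
  simpa using h

lemma supportProj_add_signOp (X : Matrix n n ℂ) :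
    supportProj X + signOp X = cfc (fun x : ℝ => 2 / x) X * X⁺ := by
  rw [posPart_eq_cfc, supportProj, spectralProj, signOp, cfc_mul_cfc, cfc_add_cfc]
  refine congrArg (cfc · X) (funext fun x => ?_)
  rcases lt_trichotomy x 0 with hx | rfl | hx
  · simp [Real.sign_of_neg hx, hx.ne, hx.le]
  · simp
  · simp [Real.sign_of_pos hx, hx.ne', hx.le]
    norm_num

lemma supportProj_sub_signOp (X : Matrix n n ℂ) :
    supportProj X - signOp X = X⁻ * cfc (fun x : ℝ => -2 / x) X := by
  rw [negPart_eq_cfc, supportProj, spectralProj, signOp, cfc_mul_cfc, cfc_sub_cfc]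
  refine congrArg (cfc · X) (funext fun x => ?_)
  rcases lt_trichotomy x 0 with hx | rfl | hx
  · simp [Real.sign_of_neg hx, hx.ne, hx.le, ← mul_div_assoc, mul_div_cancel_left₀]
    norm_num
  · simp
  · simp [Real.sign_of_pos hx, hx.ne', hx.le]

end FunctionalCalculus

section TraceNorm

variable {n m : Type*} [Fintype n] [Fintype m]

lemma trace_conjTranspose_mul_self_mul_mul {k l : Type*} [Fintype k] [Fintype l]
    (a : Matrix k m ℂ) (N : Matrix m n ℂ) (b : Matrix l n ℂ) :
    (aᴴ * a * N * (bᴴ * b) * Nᴴ).trace = (a * N * bᴴ * (a * N * bᴴ)ᴴ).trace := by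
  simp only [Matrix.conjTranspose_mul, Matrix.conjTranspose_conjTranspose, Matrix.mul_assoc]
  rw [Matrix.trace_mul_comm]
  simp only [Matrix.mul_assoc]

lemma trace_mul_mul_mul_conjTranspose_nonneg {A : Matrix m m ℂ} {B : Matrix n n ℂ} (hA : 0 ≤ A)
    (hB : 0 ≤ B) (N : Matrix m n ℂ) : 0 ≤ (A * N * B * Nᴴ).trace := by
  classical
  obtain ⟨a, rfl⟩ := CStarAlgebra.nonneg_iff_eq_star_mul_self.mp hA
  obtain ⟨b, rfl⟩ := CStarAlgebra.nonneg_iff_eq_star_mul_self.mp hB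
  simp only [Matrix.star_eq_conjTranspose, trace_conjTranspose_mul_self_mul_mul]
  exact (Matrix.posSemidef_self_mul_conjTranspose _).trace_nonneg

lemma mul_mul_eq_zero_of_trace_eq_zero {A : Matrix m m ℂ} {B : Matrix n n ℂ} (hA : 0 ≤ A)
    (hB : 0 ≤ B) {N : Matrix m n ℂ} (h : (A * N * B * Nᴴ).trace = 0) : A * N * B = 0 := by
  classical
  obtain ⟨a, rfl⟩ := CStarAlgebra.nonneg_iff_eq_star_mul_self.mp hA
  obtain ⟨b, rfl⟩ := CStarAlgebra.nonneg_iff_eq_star_mul_self.mp hB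
  simp only [Matrix.star_eq_conjTranspose, trace_conjTranspose_mul_self_mul_mul,
    Matrix.trace_mul_conjTranspose_self_eq_zero_iff] at h ⊢
  calc aᴴ * a * N * (bᴴ * b) = aᴴ * (a * N * bᴴ) * b := by simp only [Matrix.mul_assoc]
    _ = 0 := by rw [h, Matrix.mul_zero, Matrix.zero_mul]

lemma re_trace_mul_nonneg {A B : Matrix n n ℂ} (hA : 0 ≤ A) (hB : 0 ≤ B) :
    0 ≤ (A * B).trace.re := by
  classical
  simpa using (Complex.le_def.mp (trace_mul_mul_mul_conjTranspose_nonneg hA hB 1)).1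

lemma mul_eq_zero_of_re_trace_eq_zero {A B : Matrix n n ℂ} (hA : 0 ≤ A) (hB : 0 ≤ B)
    (h : (A * B).trace.re = 0) : A * B = 0 := by
  classical
  have him := (Complex.le_def.mp (trace_mul_mul_mul_conjTranspose_nonneg hA hB 1)).2
  have := mul_mul_eq_zero_of_trace_eq_zero hA hB (N := 1)
  simp only [mul_one, Matrix.conjTranspose_one] at him this
  exact this (Complex.ext h him.symm)

variable [DecidableEq n] [DecidableEq m]

lemma traceNorm_eq_re_trace_abs (X : Matrix n n ℂ) : traceNorm X = (CFC.abs X).trace.re := rfl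

lemma traceNorm_nonneg (X : Matrix n n ℂ) : 0 ≤ traceNorm X := by
  simpa [traceNorm_eq_re_trace_abs] using
    re_trace_mul_nonneg (CFC.abs_nonneg X) (zero_le_one (α := Matrix n n ℂ))

lemma traceNorm_eq_re_trace_signOp_mul {X : Matrix n n ℂ} (hX : X.IsHermitian) :
    traceNorm X = (signOp X * X).trace.re := by
  rw [signOp_mul_self hX, traceNorm_eq_re_trace_abs]

lemma traceNorm_eq_posPart_add_negPart {X : Matrix n n ℂ} (hX : X.IsHermitian) :
    traceNorm X = X⁺.trace.re + X⁻.trace.re := by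
  rw [traceNorm_eq_re_trace_abs, ← CFC.posPart_add_negPart X hX.isSelfAdjoint, Matrix.trace_add,
    Complex.add_re]

lemma traceNorm_of_nonneg {X : Matrix n n ℂ} (hX : 0 ≤ X) : traceNorm X = X.trace.re := by
  rw [traceNorm_eq_re_trace_abs, CFC.abs_of_nonneg X hX]

lemma traceNorm_neg (X : Matrix n n ℂ) : traceNorm (-X) = traceNorm X := by
  rw [traceNorm_eq_re_trace_abs, CFC.abs_neg, traceNorm_eq_re_trace_abs]

lemma traceNorm_smul (c : ℝ) (X : Matrix n n ℂ) : traceNorm (c • X) = |c| * traceNorm X := by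
  rw [traceNorm_eq_re_trace_abs, CFC.abs_smul, Matrix.trace_smul, Complex.smul_re, smul_eq_mul,
    Real.norm_eq_abs, traceNorm_eq_re_trace_abs]

lemma eq_zero_of_traceNorm_eq_zero {X : Matrix n n ℂ} (h : traceNorm X = 0) : X = 0 := by
  have habs : CFC.abs X = 0 := by
    simpa using mul_eq_zero_of_re_trace_eq_zero (CFC.abs_nonneg X) zero_le_one
      (by rwa [mul_one, ← traceNorm_eq_re_trace_abs])
  rw [← Matrix.conjTranspose_mul_self_eq_zero, ← Matrix.star_eq_conjTranspose,
    ← CFC.abs_mul_abs X, habs, mul_zero]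

lemma re_trace_mul_le_traceNorm {X T : Matrix n n ℂ} (hX : X.IsHermitian) (hT : -1 ≤ T)
    (hT' : T ≤ 1) : (T * X).trace.re ≤ traceNorm X := by
  have hpos := re_trace_mul_nonneg (sub_nonneg.mpr hT') (CFC.posPart_nonneg X)
  have hneg := re_trace_mul_nonneg (neg_le_iff_add_nonneg'.mp hT) (CFC.negPart_nonneg X)
  rw [traceNorm_eq_posPart_add_negPart hX]
  conv_lhs => rw [← CFC.posPart_sub_negPart X hX.isSelfAdjoint]
  simp only [sub_mul, add_mul, mul_sub, one_mul, Matrix.trace_sub, Matrix.trace_add,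
    Complex.sub_re, Complex.add_re] at hpos hneg ⊢
  linarith

lemma traceNorm_add_le {X Y : Matrix n n ℂ} (hX : X.IsHermitian) (hY : Y.IsHermitian) :
    traceNorm (X + Y) ≤ traceNorm X + traceNorm Y := by
  have hT := neg_one_le_signOp (hX.add hY)
  have hT' := signOp_le_one (X + Y)
  rw [traceNorm_eq_re_trace_signOp_mul (hX.add hY), mul_add, Matrix.trace_add, Complex.add_re]
  exact add_le_add (re_trace_mul_le_traceNorm hX hT hT') (re_trace_mul_le_traceNorm hY hT hT')

lemma traceNorm_sub_le {A B : Matrix n n ℂ} (hA : 0 ≤ A) (hB : 0 ≤ B) :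
    traceNorm (A - B) ≤ A.trace.re + B.trace.re := by
  rw [sub_eq_add_neg, ← traceNorm_of_nonneg hA, ← traceNorm_of_nonneg hB, ← traceNorm_neg B]
  exact traceNorm_add_le hA.isSelfAdjoint.isHermitian hB.isSelfAdjoint.neg.isHermitian

lemma traceNorm_sub_eq_iff {A B : Matrix n n ℂ} (hA : 0 ≤ A) (hB : 0 ≤ B) :
    traceNorm (A - B) = A.trace.re + B.trace.re ↔ A * B = 0 := by
  have hAB : (A - B).IsHermitian := (hA.isSelfAdjoint.sub hB.isSelfAdjoint).isHermitian
  refine ⟨fun h => ?_, fun h => ?_⟩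
  · set T := signOp (A - B)
    have hTA : 0 ≤ 1 - T := sub_nonneg.mpr (signOp_le_one _)
    have hTB : 0 ≤ 1 + T := neg_le_iff_add_nonneg'.mp (neg_one_le_signOp hAB)
    have htrA := re_trace_mul_nonneg hTA hA
    have htrB := re_trace_mul_nonneg hTB hB
    rw [traceNorm_eq_re_trace_signOp_mul hAB] at h
    simp only [sub_mul, add_mul, mul_sub, one_mul, Matrix.trace_sub, Matrix.trace_add,
      Complex.sub_re, Complex.add_re] at h htrA htrB
    have hA0 : (1 - T) * A = 0 := mul_eq_zero_of_re_trace_eq_zero hTA hA (by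
      simp only [sub_mul, one_mul, Matrix.trace_sub, Complex.sub_re]; linarith)
    have hB0 : (1 + T) * B = 0 := mul_eq_zero_of_re_trace_eq_zero hTB hB (by
      simp only [add_mul, one_mul, Matrix.trace_add, Complex.add_re]; linarith)
    have hAT : A * (1 - T) = 0 := by
      simpa [hA.isSelfAdjoint.star_eq, hTA.isSelfAdjoint.star_eq] using congrArg star hA0
    have hdouble : (2 : ℂ) • (A * B) = 0 := calc
      (2 : ℂ) • (A * B) = A * (1 - T) * B + A * ((1 + T) * B) := by rw [two_smul]; noncomm_ring
      _ = 0 := by rw [hAT, hB0, zero_mul, mul_zero, add_zero]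
    exact (smul_eq_zero_iff_right two_ne_zero).mp hdouble
  · obtain ⟨hpos, hneg⟩ := CFC.posPart_negPart_unique (a := A - B) rfl h hA hB
    rw [traceNorm_eq_posPart_add_negPart hAB, hpos, hneg]

lemma traceNorm_map_le {Φ : Matrix n n ℂ →ₗ[ℂ] Matrix m m ℂ} (hΦ : ∀ X, 0 ≤ X → 0 ≤ Φ X)
    (htr : ∀ X, (Φ X).trace = X.trace) {X : Matrix n n ℂ} (hX : X.IsHermitian) :
    traceNorm (Φ X) ≤ traceNorm X := by
  conv_lhs => rw [← CFC.posPart_sub_negPart X hX.isSelfAdjoint, map_sub]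
  refine (traceNorm_sub_le (hΦ _ (CFC.posPart_nonneg X)) (hΦ _ (CFC.negPart_nonneg X))).trans_eq ?_
  rw [htr, htr, traceNorm_eq_posPart_add_negPart hX]

end TraceNorm

section Kraus

variable {n m ι : Type*} [Fintype n] [Fintype ι]

/-- The completely positive map `X ↦ ∑ r, K r * X * (K r)ᴴ` with Kraus operators `K`. -/
def krausMap (K : ι → Matrix m n ℂ) : Matrix n n ℂ →ₗ[ℂ] Matrix m m ℂ where
  toFun X := ∑ r, K r * X * (K r)ᴴ
  map_add' X Y := by simp only [Matrix.mul_add, Matrix.add_mul, Finset.sum_add_distrib]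
  map_smul' c X := by
    simp only [Matrix.mul_smul, Matrix.smul_mul, Finset.smul_sum, RingHom.id_apply]

lemma krausMap_apply (K : ι → Matrix m n ℂ) (X : Matrix n n ℂ) :
    krausMap K X = ∑ r, K r * X * (K r)ᴴ := rfl

lemma krausMap_nonneg [Finite m] (K : ι → Matrix m n ℂ) {X : Matrix n n ℂ} (hX : 0 ≤ X) :
    0 ≤ krausMap K X :=
  (Matrix.posSemidef_sum _ fun r _ =>
    (Matrix.nonneg_iff_posSemidef.mp hX).mul_mul_conjTranspose_same (K r)).nonneg

lemma conjTranspose_krausMap (K : ι → Matrix m n ℂ) (X : Matrix n n ℂ) :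
    (krausMap K X)ᴴ = krausMap K Xᴴ := by
  simp [krausMap_apply, Matrix.conjTranspose_sum, Matrix.mul_assoc]

lemma isHermitian_krausMap (K : ι → Matrix m n ℂ) {X : Matrix n n ℂ} (hX : X.IsHermitian) :
    (krausMap K X).IsHermitian := by
  rw [Matrix.IsHermitian, conjTranspose_krausMap, hX.eq]

lemma trace_krausMap [Fintype m] (K : ι → Matrix m n ℂ) (X : Matrix n n ℂ) :
    (krausMap K X).trace = ((∑ r, (K r)ᴴ * K r) * X).trace := by
  simp only [krausMap_apply, Matrix.trace_sum, Finset.sum_mul]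
  refine Finset.sum_congr rfl fun r _ => ?_
  rw [Matrix.trace_mul_comm, Matrix.mul_assoc]

lemma trace_krausMap_mul_krausMap [Fintype m] (K : ι → Matrix m n ℂ) (A B : Matrix n n ℂ) :
    (krausMap K A * krausMap K B).trace =
      ∑ i, ∑ j, (A * ((K i)ᴴ * K j) * B * ((K i)ᴴ * K j)ᴴ).trace := by
  simp only [krausMap_apply, Finset.sum_mul_sum, Matrix.trace_sum]
  refine Finset.sum_congr rfl fun i _ => Finset.sum_congr rfl fun j _ => ?_
  rw [Matrix.mul_assoc, Matrix.mul_assoc, Matrix.trace_mul_comm]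
  simp only [Matrix.mul_assoc, Matrix.conjTranspose_mul, Matrix.conjTranspose_conjTranspose]

lemma krausMap_mul_krausMap_eq_zero_iff [Fintype m] {K : ι → Matrix m n ℂ}
    {A B : Matrix n n ℂ} (hA : 0 ≤ A) (hB : 0 ≤ B) :
    krausMap K A * krausMap K B = 0 ↔ ∀ i j, A * ((K i)ᴴ * K j) * B = 0 := by
  refine ⟨fun h i j => mul_mul_eq_zero_of_trace_eq_zero hA hB ?_, fun h => ?_⟩
  · have hterm := fun i j => trace_mul_mul_mul_conjTranspose_nonneg hA hB ((K i)ᴴ * K j)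
    have hsum := congrArg Matrix.trace h
    rw [trace_krausMap_mul_krausMap, Matrix.trace_zero,
      Fintype.sum_eq_zero_iff_of_nonneg fun i => Finset.sum_nonneg fun j _ => hterm i j] at hsum
    exact congrFun ((Fintype.sum_eq_zero_iff_of_nonneg (hterm i)).mp (congrFun hsum i)) j
  · simp only [krausMap_apply, Finset.sum_mul_sum]
    refine Finset.sum_eq_zero fun i _ => Finset.sum_eq_zero fun j _ => ?_
    calc K i * A * (K i)ᴴ * (K j * B * (K j)ᴴ) = K i * (A * ((K i)ᴴ * K j) * B) * (K j)ᴴ := by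
          simp only [Matrix.mul_assoc]
      _ = 0 := by rw [h, Matrix.mul_zero, Matrix.zero_mul]

lemma isCompletelyPositive_krausMap [Finite m] (K : ι → Matrix m n ℂ) :
    IsCompletelyPositive (krausMap K) := by
  intro k X hX
  have hcomp : Matrix.comp (Fin k) (Fin k) m m ℂ (X.map (krausMap K)) =
      ∑ r, ((1 : Matrix (Fin k) (Fin k) ℂ) ⊗ₖ K r) * Matrix.comp (Fin k) (Fin k) n n ℂ X *
        ((1 : Matrix (Fin k) (Fin k) ℂ) ⊗ₖ K r)ᴴ := by
    ext ⟨p, a⟩ ⟨q, b⟩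
    simp [krausMap_apply, Matrix.sum_apply, Matrix.mul_apply, Fintype.sum_prod_type,
      Matrix.one_apply, apply_ite, Finset.sum_ite_irrel]
  rw [hcomp]
  exact Matrix.posSemidef_sum _ fun r _ => hX.mul_mul_conjTranspose_same _

lemma IsCompletelyPositive.posSemidef_comp {n m ι : Type*} [Finite ι]
    {Φ : Matrix n n ℂ →ₗ[ℂ] Matrix m m ℂ}
    (hΦ : IsCompletelyPositive Φ) {X : Matrix ι ι (Matrix n n ℂ)}
    (hX : (Matrix.comp ι ι n n ℂ X).PosSemidef) :
    (Matrix.comp ι ι m m ℂ (X.map Φ)).PosSemidef := by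
  obtain ⟨k, ⟨e⟩⟩ := Finite.exists_equiv_fin ι
  have hreindex := hΦ _ (X.submatrix e.symm e.symm) (hX.submatrix (Prod.map e.symm id))
  convert hreindex.submatrix (Prod.map e id)
  ext ⟨i, a⟩ ⟨j, b⟩
  simp

variable [DecidableEq n]

/-- The Choi matrix of a linear map between matrix algebras: its `(i, j)` block is the image of the
matrix unit `Matrix.single i j 1`. -/
def choiMatrix (Φ : Matrix n n ℂ →ₗ[ℂ] Matrix m m ℂ) : Matrix (n × m) (n × m) ℂ :=
  Matrix.comp n n m m ℂ (Matrix.of fun i j => Φ (Matrix.single i j 1))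

lemma IsCompletelyPositive.posSemidef_choiMatrix {n m : Type*} [Finite n] [DecidableEq n]
    {Φ : Matrix n n ℂ →ₗ[ℂ] Matrix m m ℂ}
    (hΦ : IsCompletelyPositive Φ) : (choiMatrix Φ).PosSemidef := by
  refine hΦ.posSemidef_comp (X := Matrix.of fun i j => Matrix.single i j 1) ?_
  convert Matrix.posSemidef_vecMulVec_self_star
    (fun ia : n × n => if ia.1 = ia.2 then (1 : ℂ) else 0) using 1
  ext ⟨i, a⟩ ⟨j, b⟩
  simp only [Matrix.comp_apply, Matrix.of_apply, Matrix.single_apply, Matrix.vecMulVec_apply,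
    Pi.star_apply, ite_and]
  split_ifs <;> simp

variable [Fintype m]

lemma isCPTP_krausMap {K : ι → Matrix m n ℂ} (hK : ∑ r, (K r)ᴴ * K r = 1) :
    IsCPTP (krausMap K) where
  completelyPositive := isCompletelyPositive_krausMap K
  trace_map X := by rw [trace_krausMap, hK, one_mul]

/-- Choi's theorem: a factorisation `choiMatrix Φ = Bᴴ * B` turns the rows of `B` into Kraus
operators. -/
lemma IsCompletelyPositive.exists_eq_krausMap {n m : Type*} [Fintype n] [Fintype m]
    {Φ : Matrix n n ℂ →ₗ[ℂ] Matrix m m ℂ} (hΦ : IsCompletelyPositive Φ) :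
    ∃ K : n × m → Matrix m n ℂ, Φ = krausMap K := by
  classical
  obtain ⟨B, hB⟩ := CStarAlgebra.nonneg_iff_eq_star_mul_self.mp hΦ.posSemidef_choiMatrix.nonneg
  refine ⟨fun r => Matrix.of fun a i => star (B r (i, a)), ?_⟩
  refine Matrix.ext_linearMap ℂ fun i j => LinearMap.ext_ring ?_
  ext a b
  have hentry := congrFun (congrFun hB (i, a)) (j, b)
  simp only [choiMatrix, Matrix.comp_apply, Matrix.of_apply, Matrix.mul_apply,
    Matrix.star_apply] at hentry
  simp [krausMap_apply, Matrix.sum_apply, hentry, Matrix.mul_apply, Matrix.single_apply, ite_and]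

lemma IsCPTP.exists_eq_krausMap {Φ : Matrix n n ℂ →ₗ[ℂ] Matrix m m ℂ} (hΦ : IsCPTP Φ) :
    ∃ K : n × m → Matrix m n ℂ, Φ = krausMap K ∧ ∑ r, (K r)ᴴ * K r = 1 := by
  obtain ⟨K, rfl⟩ := hΦ.completelyPositive.exists_eq_krausMap
  refine ⟨K, rfl, Matrix.ext_iff_trace_mul_right.mpr fun X => ?_⟩
  rw [← trace_krausMap, hΦ.trace_map, one_mul]

lemma traceNorm_krausMap_le [DecidableEq m] {K : ι → Matrix m n ℂ} (hK : ∑ r, (K r)ᴴ * K r = 1)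
    {X : Matrix n n ℂ} (hX : X.IsHermitian) : traceNorm (krausMap K X) ≤ traceNorm X :=
  traceNorm_map_le (fun _ => krausMap_nonneg K) (isCPTP_krausMap hK).trace_map hX

end Kraus

section Converse

lemma convex_stateSpace (n : Type*) [Fintype n] : Convex ℝ (stateSpace n) := by
  rintro ρ ⟨hρ, hρ1⟩ σ ⟨hσ, hσ1⟩ a b ha hb hab
  refine ⟨(hρ.smul ha).add (hσ.smul hb), ?_⟩
  rw [Matrix.trace_add, Matrix.trace_smul, Matrix.trace_smul, hρ1, hσ1, ← add_smul, hab, one_smul]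

lemma isHermitian_smul_sub_smul {n : Type*} {A B : Matrix n n ℂ} (hA : A.IsHermitian)
    (hB : B.IsHermitian) (a b : ℝ) : (a • A - b • B).IsHermitian :=
  (hA.smul (IsSelfAdjoint.all a)).sub (hB.smul (IsSelfAdjoint.all b))

theorem isPreserved_of_isFixed {n m : Type*} [Fintype n] [DecidableEq n] [Fintype m]
    [DecidableEq m] {E : Matrix n n ℂ →ₗ[ℂ] Matrix m m ℂ} (hE : IsCPTP E)
    {C : Set (Matrix n n ℂ)} (hC : C ⊆ stateSpace n) {R : Matrix m m ℂ →ₗ[ℂ] Matrix n n ℂ}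
    (hR : IsCPTP R) (hRE : IsFixed (R ∘ₗ E) C) : IsPreserved E C := by
  obtain ⟨K, rfl, hK⟩ := hE.exists_eq_krausMap
  obtain ⟨L, rfl, hL⟩ := hR.exists_eq_krausMap
  refine ⟨hC, fun ρ hρ σ hσ p _ => ?_⟩
  have hfix : convexHull ℝ C ⊆ {τ | krausMap L (krausMap K τ) = τ} :=
    convexHull_min hRE fun x hx y hy a b _ _ _ => by
      simp only [Set.mem_ofPred_eq, map_add, LinearMap.map_smul_of_tower] at hx hy ⊢
      rw [hx, hy]
  have hstate := convexHull_min hC (convex_stateSpace n)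
  have hX := isHermitian_smul_sub_smul (hstate hρ).1.isHermitian (hstate hσ).1.isHermitian p (1 - p)
  have hLK : krausMap L (krausMap K (p • ρ - (1 - p) • σ)) = p • ρ - (1 - p) • σ := by
    have hρ' := hfix hρ
    have hσ' := hfix hσ
    simp only [Set.mem_ofPred_eq] at hρ' hσ'
    simp only [map_sub, LinearMap.map_smul_of_tower, hρ', hσ']
  refine le_antisymm (traceNorm_krausMap_le hK hX) ?_
  conv_lhs => rw [← hLK]
  exact traceNorm_krausMap_le hL (isHermitian_krausMap K hX)

end Converse

section CorrectableAlgebra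

variable {n m ι : Type*} [Fintype n] [DecidableEq n] [Fintype m]
  {K : ι → Matrix m n ℂ}

/-- The algebra of matrices commuting with `P` and with all compressed Knill-Laflamme products
`P * (K i)ᴴ * K j * P`. For a projection `P`, its elements supported on `P` are the observables of
`P` that survive the noise `krausMap K`. -/
def correctableAlgebra (K : ι → Matrix m n ℂ) (P : Matrix n n ℂ) :
    StarSubalgebra ℂ (Matrix n n ℂ) :=
  StarSubalgebra.centralizer ℂ
    (insert P (Set.range fun ij : ι × ι => P * ((K ij.1)ᴴ * K ij.2) * P))

lemma mem_correctableAlgebra {P : Matrix n n ℂ} (hP : P.IsHermitian) {a : Matrix n n ℂ} :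
    a ∈ correctableAlgebra K P ↔
      Commute P a ∧ ∀ i j, Commute (P * ((K i)ᴴ * K j) * P) a := by
  have hstar : ∀ i j, star (P * ((K i)ᴴ * K j) * P) = P * ((K j)ᴴ * K i) * P := fun i j => by
    simp [Matrix.star_eq_conjTranspose, hP.eq, Matrix.mul_assoc]
  rw [correctableAlgebra, StarSubalgebra.mem_centralizer_iff]
  refine ⟨fun h => ⟨(h P (Set.mem_insert _ _)).1, fun i j => (h _ (.inr ⟨(i, j), rfl⟩)).1⟩, ?_⟩
  rintro ⟨hPa, ha⟩ _ (rfl | ⟨⟨i, j⟩, rfl⟩)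
  · exact ⟨hPa, by rw [Matrix.star_eq_conjTranspose, hP.eq, hPa.eq]⟩
  · exact ⟨ha i j, by rw [hstar]; exact ha j i⟩

lemma mem_correctableAlgebra_self {P : Matrix n n ℂ} (hP : IsStarProjection P) :
    P ∈ correctableAlgebra K P := by
  refine (mem_correctableAlgebra hP.isSelfAdjoint.isHermitian).mpr ⟨.refl P, fun i j => ?_⟩
  simp only [Commute, SemiconjBy, Matrix.mul_assoc]
  rw [hP.isIdempotentElem.eq, ← Matrix.mul_assoc P P, hP.isIdempotentElem.eq]

lemma cfc_mem_of_mem {A : StarSubalgebra ℂ (Matrix n n ℂ)} {X : Matrix n n ℂ} (hX : X ∈ A)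
    (f : ℝ → ℝ) : cfc f X ∈ A :=
  have : IsClosed (A : Set (Matrix n n ℂ)) :=
    A.toSubalgebra.toSubmodule.closed_of_finiteDimensional
  cfc_mem f hX

variable [Fintype ι] [DecidableEq m]

lemma traceNorm_krausMap_eq_iff (hK : ∑ r, (K r)ᴴ * K r = 1) {X : Matrix n n ℂ}
    (hX : X.IsHermitian) : traceNorm (krausMap K X) = traceNorm X ↔
      ∀ i j, X⁺ * ((K i)ᴴ * K j) * X⁻ = 0 := by
  have hpos := CFC.posPart_nonneg X
  have hneg := CFC.negPart_nonneg X
  rw [← krausMap_mul_krausMap_eq_zero_iff hpos hneg,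
    ← traceNorm_sub_eq_iff (krausMap_nonneg K hpos) (krausMap_nonneg K hneg), ← map_sub,
    CFC.posPart_sub_negPart X hX.isSelfAdjoint, (isCPTP_krausMap hK).trace_map,
    (isCPTP_krausMap hK).trace_map, traceNorm_eq_posPart_add_negPart hX]

lemma signOp_mem_correctableAlgebra (hK : ∑ r, (K r)ᴴ * K r = 1) {X : Matrix n n ℂ}
    (hX : X.IsHermitian) (h : traceNorm (krausMap K X) = traceNorm X) :
    signOp X ∈ correctableAlgebra K (supportProj X) := by
  set P := supportProj X
  set T := signOp X
  have hP : Pᴴ = P := (isStarProjection_supportProj X).isSelfAdjoint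
  have hT : Tᴴ = T := isHermitian_signOp X
  have hPT : P * T = T := supportProj_mul_signOp hX
  have hTP : T * P = T := signOp_mul_supportProj hX
  have hleft : ∀ i j, (P + T) * ((K i)ᴴ * K j) * (P - T) = 0 := fun i j => by
    rw [supportProj_add_signOp, supportProj_sub_signOp, ← mul_assoc, mul_assoc (cfc _ X),
      mul_assoc (cfc _ X), (traceNorm_krausMap_eq_iff hK hX).mp h i j, mul_zero, zero_mul]
  have hright : ∀ i j, (P - T) * ((K i)ᴴ * K j) * (P + T) = 0 := fun i j => by
    simpa [hP, hT, Matrix.mul_assoc] using congrArg Matrix.conjTranspose (hleft j i)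
  refine (mem_correctableAlgebra hP).mpr ⟨hPT.trans hTP.symm, fun i j => ?_⟩
  set B := (K i)ᴴ * K j
  have hdouble : (2 : ℂ) • (T * B * P - P * B * T) = 0 := calc
    (2 : ℂ) • (T * B * P - P * B * T) = (P + T) * B * (P - T) - (P - T) * B * (P + T) := by
      rw [two_smul]; noncomm_ring
    _ = 0 := by rw [hleft, hright, sub_zero]
  calc P * B * P * T = P * B * T := by rw [mul_assoc, hPT]
    _ = T * B * P := (sub_eq_zero.mp ((smul_eq_zero_iff_right two_ne_zero).mp hdouble)).symm
    _ = T * (P * B * P) := by rw [← mul_assoc, ← mul_assoc, hTP]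

lemma traceNorm_krausMap_of_mem_correctableAlgebra (hK : ∑ r, (K r)ᴴ * K r = 1)
    {P X : Matrix n n ℂ} (hP : P.IsHermitian) (hX : X.IsHermitian)
    (hmem : X ∈ correctableAlgebra K P) (hXP : X * P = X) :
    traceNorm (krausMap K X) = traceNorm X := by
  refine (traceNorm_krausMap_eq_iff hK hX).mpr fun i j => ?_
  have hpos : X⁺ * P = X⁺ := by
    rw [posPart_eq_cfc]; exact cfc_mul_eq_self (by simp) hX hXP
  have hneg : P * X⁻ = X⁻ := by
    refine mul_eq_self_of_mul_eq_self (CFC.negPart_nonneg X).isSelfAdjoint hP.isSelfAdjoint ?_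
    rw [negPart_eq_cfc]; exact cfc_mul_eq_self (by simp) hX hXP
  have hcomm : Commute (P * ((K i)ᴴ * K j) * P) X⁺ := by
    rw [posPart_eq_cfc]
    exact ((mem_correctableAlgebra hP).mp (cfc_mem_of_mem hmem _)).2 i j
  calc X⁺ * ((K i)ᴴ * K j) * X⁻ = X⁺ * (P * ((K i)ᴴ * K j) * P) * X⁻ := by
        conv_lhs => rw [← hpos, ← hneg]
        simp only [Matrix.mul_assoc]
    _ = 0 := by rw [← hcomm.eq, mul_assoc, CFC.posPart_mul_negPart, mul_zero]

end CorrectableAlgebra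

section ConditionalExpectation

variable {n : Type*} [Fintype n]

/-- The bilinear form `(X, Y) ↦ tr (X * Y)` on matrices, which defines the orthogonality used for
conditional expectations. -/
def traceForm (n : Type*) [Fintype n] : LinearMap.BilinForm ℂ (Matrix n n ℂ) :=
  (LinearMap.mul ℂ (Matrix n n ℂ)).compr₂ (Matrix.traceLinearMap n ℂ ℂ)

lemma traceForm_apply (X Y : Matrix n n ℂ) : traceForm n X Y = (X * Y).trace := rfl

lemma isRefl_traceForm : (traceForm n).IsRefl := fun X Y h => by
  rw [traceForm_apply, Matrix.trace_mul_comm, ← traceForm_apply, h]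

variable [DecidableEq n]

lemma eq_zero_of_forall_trace_mul_eq_zero {A : StarSubalgebra ℂ (Matrix n n ℂ)}
    {b : Matrix n n ℂ} (hb : b ∈ A) (h : ∀ a ∈ A, (a * b).trace = 0) : b = 0 :=
  Matrix.trace_conjTranspose_mul_self_eq_zero_iff.mp (h _ (star_mem hb))

lemma isCompl_orthogonal_traceForm (A : StarSubalgebra ℂ (Matrix n n ℂ)) :
    IsCompl A.toSubalgebra.toSubmodule ((traceForm n).orthogonal A.toSubalgebra.toSubmodule) := by
  refine LinearMap.BilinForm.isCompl_orthogonal_of_restrict_nondegenerate isRefl_traceForm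
    ⟨fun b h => ?_, fun b h => ?_⟩
  · refine Subtype.ext (eq_zero_of_forall_trace_mul_eq_zero b.2 fun a ha => ?_)
    rw [Matrix.trace_mul_comm]
    exact h ⟨a, ha⟩
  · exact Subtype.ext (eq_zero_of_forall_trace_mul_eq_zero b.2 fun a ha => h ⟨a, ha⟩)

/-- The trace-preserving conditional expectation onto a star subalgebra of matrices, i.e. the
projection along its orthogonal complement for the form `tr (X * Y)`. -/
def conditionalExpectation (A : StarSubalgebra ℂ (Matrix n n ℂ)) :
    Matrix n n ℂ →ₗ[ℂ] Matrix n n ℂ :=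
  A.toSubalgebra.toSubmodule.subtype ∘ₗ
    A.toSubalgebra.toSubmodule.projectionOnto _ (isCompl_orthogonal_traceForm A)

variable {A : StarSubalgebra ℂ (Matrix n n ℂ)}

lemma conditionalExpectation_mem (A : StarSubalgebra ℂ (Matrix n n ℂ)) (X : Matrix n n ℂ) :
    conditionalExpectation A X ∈ A :=
  (A.toSubalgebra.toSubmodule.projectionOnto _ (isCompl_orthogonal_traceForm A) X).2

lemma trace_mul_conditionalExpectation {a : Matrix n n ℂ} (ha : a ∈ A) (X : Matrix n n ℂ) :
    (a * conditionalExpectation A X).trace = (a * X).trace := by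
  have hker : X - conditionalExpectation A X ∈
      (traceForm n).orthogonal A.toSubalgebra.toSubmodule := by
    rw [← Submodule.ker_projectionOnto (isCompl_orthogonal_traceForm A), LinearMap.mem_ker, map_sub,
      conditionalExpectation, LinearMap.comp_apply, Submodule.subtype_apply,
      Submodule.projectionOnto_apply_left, sub_self]
  have htrace : (a * (X - conditionalExpectation A X)).trace = 0 := hker a ha
  rw [mul_sub, Matrix.trace_sub, sub_eq_zero] at htrace
  exact htrace.symm

lemma trace_conditionalExpectation (X : Matrix n n ℂ) :
    (conditionalExpectation A X).trace = X.trace := by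
  simpa only [one_mul] using trace_mul_conditionalExpectation (one_mem A) X

lemma conditionalExpectation_eq {X Y : Matrix n n ℂ} (hY : Y ∈ A)
    (h : ∀ a ∈ A, (a * Y).trace = (a * X).trace) : conditionalExpectation A X = Y := by
  refine sub_eq_zero.mp (eq_zero_of_forall_trace_mul_eq_zero
    (sub_mem (conditionalExpectation_mem A X) hY) fun a ha => ?_)
  rw [mul_sub, Matrix.trace_sub, trace_mul_conditionalExpectation ha, h a ha, sub_self]

lemma conditionalExpectation_mul {b : Matrix n n ℂ} (hb : b ∈ A) (X : Matrix n n ℂ) :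
    conditionalExpectation A (X * b) = conditionalExpectation A X * b := by
  refine conditionalExpectation_eq (mul_mem (conditionalExpectation_mem A X) hb) fun a ha => ?_
  rw [← mul_assoc, Matrix.trace_mul_comm, ← mul_assoc,
    trace_mul_conditionalExpectation (mul_mem hb ha), mul_assoc, Matrix.trace_mul_comm, mul_assoc]

lemma conditionalExpectation_conjTranspose (X : Matrix n n ℂ) :
    conditionalExpectation A Xᴴ = (conditionalExpectation A X)ᴴ := by
  refine conditionalExpectation_eq (star_mem (conditionalExpectation_mem A X)) fun a ha => ?_
  have hconj := congrArg star (trace_mul_conditionalExpectation (star_mem ha) X)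
  rw [← Matrix.trace_conjTranspose, ← Matrix.trace_conjTranspose, Matrix.conjTranspose_mul,
    Matrix.conjTranspose_mul, ← Matrix.star_eq_conjTranspose (star a), star_star] at hconj
  rw [Matrix.trace_mul_comm, hconj, Matrix.trace_mul_comm]

lemma isHermitian_conditionalExpectation {X : Matrix n n ℂ} (hX : X.IsHermitian) :
    (conditionalExpectation A X).IsHermitian := by
  rw [Matrix.IsHermitian, ← conditionalExpectation_conjTranspose, hX.eq]

/-- The negative part `N` of `Y = conditionalExpectation A X` lies in `A`, so
`tr (N * X) = tr (N * Y) = - tr (N * N)`. -/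
lemma conditionalExpectation_nonneg {X : Matrix n n ℂ} (hX : 0 ≤ X) :
    0 ≤ conditionalExpectation A X := by
  set Y := conditionalExpectation A X
  have hY : IsSelfAdjoint Y := isHermitian_conditionalExpectation hX.isSelfAdjoint.isHermitian
  have hN : Y⁻ ∈ A := by
    rw [negPart_eq_cfc]
    exact cfc_mem_of_mem (conditionalExpectation_mem A X) _
  have hNY : Y⁻ * Y = -(Y⁻ * Y⁻) := calc
    Y⁻ * Y = Y⁻ * (Y⁺ - Y⁻) := by rw [CFC.posPart_sub_negPart Y hY]
    _ = -(Y⁻ * Y⁻) := by rw [mul_sub, CFC.negPart_mul_posPart, zero_sub]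
  have hle := re_trace_mul_nonneg (CFC.negPart_nonneg Y) hX
  have hge := re_trace_mul_nonneg (CFC.negPart_nonneg Y) (CFC.negPart_nonneg Y)
  rw [← trace_mul_conditionalExpectation hN, hNY, Matrix.trace_neg, Complex.neg_re] at hle
  have hsq := mul_eq_zero_of_re_trace_eq_zero (CFC.negPart_nonneg Y) (CFC.negPart_nonneg Y)
    (le_antisymm (neg_nonneg.mp hle) hge)
  have hzero : Y⁻ = 0 := by
    rw [← Matrix.conjTranspose_mul_self_eq_zero, ← Matrix.star_eq_conjTranspose,
      (CFC.negPart_nonneg Y).isSelfAdjoint.star_eq, hsq]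
  rw [← CFC.posPart_sub_negPart Y hY, hzero, sub_zero]
  exact CFC.posPart_nonneg Y

lemma traceNorm_conditionalExpectation_le {X : Matrix n n ℂ} (hX : X.IsHermitian) :
    traceNorm (conditionalExpectation A X) ≤ traceNorm X :=
  traceNorm_map_le (fun _ => conditionalExpectation_nonneg) trace_conditionalExpectation hX

lemma traceNorm_conditionalExpectation_of_signOp_mem {X : Matrix n n ℂ} (hX : X.IsHermitian)
    (h : signOp X ∈ A) : traceNorm (conditionalExpectation A X) = traceNorm X := by
  refine le_antisymm (traceNorm_conditionalExpectation_le hX) ?_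
  rw [traceNorm_eq_re_trace_signOp_mul hX, ← trace_mul_conditionalExpectation h]
  exact re_trace_mul_le_traceNorm (isHermitian_conditionalExpectation hX) (neg_one_le_signOp hX)
    (signOp_le_one X)

end ConditionalExpectation

section Support

variable {n : Type*} [Fintype n]

lemma mul_eq_zero_of_add_mul_eq_zero {A B Z : Matrix n n ℂ} (hA : 0 ≤ A) (hB : 0 ≤ B)
    (h : (A + B) * Z = 0) : A * Z = 0 := by
  classical
  have hone : (0 : Matrix n n ℂ) ≤ 1 := zero_le_one
  have hsum : (A * Z * 1 * Zᴴ).trace + (B * Z * 1 * Zᴴ).trace = 0 := by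
    rw [← Matrix.trace_add, ← add_mul, ← add_mul, ← add_mul, h, zero_mul, zero_mul,
      Matrix.trace_zero]
  rw [add_eq_zero_iff_of_nonneg (trace_mul_mul_mul_conjTranspose_nonneg hA hone Z)
    (trace_mul_mul_mul_conjTranspose_nonneg hB hone Z)] at hsum
  simpa only [mul_one] using mul_mul_eq_zero_of_trace_eq_zero hA hone hsum.1

variable [DecidableEq n]

/-- A minimiser of the kernel dimension works: it annihilates no more than its mean with any other
element does. -/
lemma exists_forall_mul_supportProj_eq {S : Set (Matrix n n ℂ)} (hS : Convex ℝ S)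
    (hne : S.Nonempty) (hpos : ∀ ρ ∈ S, 0 ≤ ρ) :
    ∃ σ ∈ S, ∀ ρ ∈ S, ρ * supportProj σ = ρ := by
  let kerDim : Matrix n n ℂ → ℕ := fun ρ =>
    Module.finrank ℂ (LinearMap.ker (LinearMap.mulLeft ℂ ρ))
  refine ⟨_, Function.argminOn_mem kerDim S hne, fun ρ hρ => ?_⟩
  set σ := Function.argminOn kerDim S hne
  have hσ : σ ∈ S := Function.argminOn_mem kerDim S hne
  set τ := (2⁻¹ : ℝ) • σ + (2⁻¹ : ℝ) • ρ
  have hτ : τ ∈ S := hS hσ hρ (by norm_num) (by norm_num) (by norm_num)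
  have hmul : ∀ Z, τ * Z = 0 → (σ + ρ) * Z = 0 := fun Z hZ =>
    (smul_eq_zero_iff_right (r := (2⁻¹ : ℝ)) (by norm_num)).mp
      (by rwa [← smul_mul_assoc, smul_add])
  have hker : LinearMap.ker (LinearMap.mulLeft ℂ τ) = LinearMap.ker (LinearMap.mulLeft ℂ σ) :=
    Submodule.eq_of_le_of_finrank_le
      (fun Z hZ => mul_eq_zero_of_add_mul_eq_zero (hpos σ hσ) (hpos ρ hρ) (hmul Z hZ))
      (Function.argminOn_le kerDim S hτ)
  have hσP : σ * (1 - supportProj σ) = 0 := by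
    rw [mul_sub, mul_one, mul_supportProj (hpos σ hσ).isSelfAdjoint.isHermitian, sub_self]
  have hτP : τ * (1 - supportProj σ) = 0 := (hker.symm.le :) hσP
  have hρP := mul_eq_zero_of_add_mul_eq_zero (hpos ρ hρ) (hpos σ hσ)
    (by rw [add_comm]; exact hmul _ hτP)
  rw [mul_sub, mul_one, sub_eq_zero] at hρP
  exact hρP.symm

lemma isUnit_add_one_sub_supportProj {σ : Matrix n n ℂ} (hσ : σ.IsHermitian) :
    IsUnit (σ + (1 - supportProj σ)) := by
  have hcfc : σ + (1 - supportProj σ) =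
      cfc (fun x : ℝ => x + (1 - Set.indicator {0}ᶜ 1 x)) σ := by
    rw [← cfc_add_cfc (fun x => x), ← cfc_sub_cfc (fun _ => 1), cfc_id' ℝ σ hσ.isSelfAdjoint,
      cfc_const_one ℝ σ hσ.isSelfAdjoint, supportProj, spectralProj]
  rw [hcfc, isUnit_cfc_iff _ σ (continuousOn_spectrum _ σ) hσ.isSelfAdjoint]
  intro x _
  by_cases hx : x = 0 <;> simp [hx]

lemma finite_setOf_not_isUnit_add_smul (X : Matrix n n ℂ) {U : Matrix n n ℂ} (hU : IsUnit U) :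
    {ε : ℝ | ¬ IsUnit (X + ε • U)}.Finite := by
  obtain ⟨u, rfl⟩ := hU
  let Y : Matrix n n ℂ := (↑u⁻¹ : Matrix n n ℂ) * X
  have hfactor : ∀ ε : ℝ, X + ε • (u : Matrix n n ℂ) =
      u * (algebraMap ℝ (Matrix n n ℂ) ε - -Y) := fun ε => by
    rw [sub_neg_eq_add, mul_add, Units.mul_inv_cancel_left, Algebra.algebraMap_eq_smul_one,
      mul_smul_comm, mul_one, add_comm]
  refine (Matrix.finite_real_spectrum (A := -Y)).subset fun ε hε hunit => hε ?_
  rw [hfactor]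
  exact u.isUnit.mul hunit

lemma exists_supportProj_add_smul_eq {X σ : Matrix n n ℂ} (hX : X.IsHermitian)
    (hσ : σ.IsHermitian) (hXσ : X * supportProj σ = X) {δ : ℝ} (hδ : 0 < δ) :
    ∃ ε ∈ Set.Ioo 0 δ, supportProj (X + ε • σ) = supportProj σ := by
  obtain ⟨ε, hε, hunit⟩ := (Set.Ioo_infinite hδ).exists_notMem_finite
    (finite_setOf_not_isUnit_add_smul X (isUnit_add_one_sub_supportProj hσ))
  refine ⟨ε, hε, ?_⟩
  rw [Set.mem_ofPred_eq, not_not] at hunit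
  set P := supportProj σ
  set Y := X + ε • σ
  have hP : IsStarProjection P := isStarProjection_supportProj σ
  have hY : Y.IsHermitian := hX.add (hσ.smul (IsSelfAdjoint.all ε))
  have hYP : Y * P = Y := by rw [add_mul, smul_mul_assoc, hXσ, mul_supportProj hσ]
  have hmulP : (X + ε • (σ + (1 - P))) * P = Y := by
    rw [add_mul, smul_mul_assoc, add_mul, sub_mul, one_mul, hP.isIdempotentElem.eq, sub_self,
      add_zero, hXσ, mul_supportProj hσ]
  have hzero : P * (1 - supportProj Y) = 0 := hunit.mul_right_eq_zero.mp (by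
    rw [← mul_assoc, hmulP, mul_sub, mul_one, mul_supportProj hY, sub_self])
  rw [mul_sub, mul_one, sub_eq_zero] at hzero
  have hadj := congrArg star hzero
  rw [star_mul, hP.isSelfAdjoint.star_eq, (isStarProjection_supportProj Y).isSelfAdjoint.star_eq,
    supportProj_mul_eq_self hY hYP] at hadj
  exact hadj.symm

end Support

section Span

variable {E : Type*} [AddCommGroup E] [Module ℝ E]

lemma convexHull_subset_span (S : Set E) : convexHull ℝ S ⊆ Submodule.span ℝ S :=
  convexHull_min Submodule.subset_span (Submodule.span ℝ S).convex

lemma exists_eq_smul_sub_smul_of_mem_span {S : Set E} (hS : Convex ℝ S) (hne : S.Nonempty)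
    {x : E} (hx : x ∈ Submodule.span ℝ S) :
    ∃ y ∈ S, ∃ z ∈ S, ∃ a b : ℝ, 0 ≤ a ∧ 0 ≤ b ∧ x = a • y - b • z := by
  obtain ⟨y₀, hy₀⟩ := hne
  induction hx using Submodule.span_induction with
  | mem x hx => exact ⟨x, hx, x, hx, 1, 0, zero_le_one, le_rfl, by simp⟩
  | zero => exact ⟨y₀, hy₀, y₀, hy₀, 0, 0, le_rfl, le_rfl, by simp⟩
  | add x x' _ _ hx hx' =>
    obtain ⟨y, hy, z, hz, a, b, ha, hb, rfl⟩ := hx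
    obtain ⟨y', hy', z', hz', a', b', ha', hb', rfl⟩ := hx'
    obtain ⟨u, hu, hyu⟩ := hS.exists_mem_add_smul_eq hy hy' ha ha'
    obtain ⟨v, hv, hzv⟩ := hS.exists_mem_add_smul_eq hz hz' hb hb'
    refine ⟨u, hu, v, hv, a + a', b + b', add_nonneg ha ha', add_nonneg hb hb', ?_⟩
    rw [hyu, hzv]
    abel
  | smul c x _ hx =>
    obtain ⟨y, hy, z, hz, a, b, ha, hb, rfl⟩ := hx
    rcases le_total 0 c with hc | hc
    · exact ⟨y, hy, z, hz, c * a, c * b, mul_nonneg hc ha, mul_nonneg hc hb, by module⟩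
    · exact ⟨z, hz, y, hy, -c * b, -c * a, mul_nonneg (neg_nonneg.mpr hc) hb,
        mul_nonneg (neg_nonneg.mpr hc) ha, by module⟩

variable {n m ι : Type*} [Fintype n] [Fintype m]

lemma isHermitian_of_mem_span {C : Set (Matrix n n ℂ)} (hC : C ⊆ stateSpace n)
    {X : Matrix n n ℂ} (hX : X ∈ Submodule.span ℝ C) : X.IsHermitian :=
  (Submodule.span_le (p := selfAdjoint.submodule ℝ (Matrix n n ℂ))).mpr
    (fun _ hρ => (hC hρ).1.isHermitian) hX

variable [DecidableEq n] [DecidableEq m]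

lemma IsPreserved.traceNorm_map_of_mem_span {E : Matrix n n ℂ →ₗ[ℂ] Matrix m m ℂ}
    {C : Set (Matrix n n ℂ)} (hC : IsPreserved E C) (hne : C.Nonempty) {X : Matrix n n ℂ}
    (hX : X ∈ Submodule.span ℝ C) : traceNorm (E X) = traceNorm X := by
  obtain ⟨ρ, hρ, σ, hσ, a, b, ha, hb, rfl⟩ :=
    exists_eq_smul_sub_smul_of_mem_span (convex_convexHull ℝ C) hne.convexHull
      (Submodule.span_mono (subset_convexHull ℝ C) hX)
  rcases (add_nonneg ha hb).eq_or_lt with hab | hab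
  · obtain ⟨rfl, rfl⟩ := (add_eq_zero_iff_of_nonneg ha hb).mp hab.symm
    simp [traceNorm]
  · have hscale : a • ρ - b • σ = (a + b) • ((a / (a + b)) • ρ - (1 - a / (a + b)) • σ) := by
      match_scalars
      · field_simp
      · field_simp
        ring
    rw [hscale, LinearMap.map_smul_of_tower, traceNorm_smul, traceNorm_smul,
      hC.2 ρ hρ σ hσ _ ⟨by positivity, (div_le_one hab).mpr (by linarith)⟩]

variable [Fintype ι]

/-- The shifts `X + ε • σ` have the support of `σ` for almost all `ε`, which makes their sign lie
in the correctable algebra; now let `ε` tend to zero. -/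
lemma traceNorm_conditionalExpectation_correctableAlgebra {K : ι → Matrix m n ℂ}
    (hK : ∑ r, (K r)ᴴ * K r = 1) {V : Submodule ℝ (Matrix n n ℂ)}
    (hherm : ∀ X ∈ V, X.IsHermitian) (hiso : ∀ X ∈ V, traceNorm (krausMap K X) = traceNorm X)
    {σ : Matrix n n ℂ} (hσ : σ ∈ V) (hsupp : ∀ X ∈ V, X * supportProj σ = X)
    {X : Matrix n n ℂ} (hX : X ∈ V) :
    traceNorm (conditionalExpectation (correctableAlgebra K (supportProj σ)) X) = traceNorm X := by
  set e := conditionalExpectation (correctableAlgebra K (supportProj σ))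
  refine le_antisymm (traceNorm_conditionalExpectation_le (hherm X hX))
    (le_of_forall_pos_le_add fun η hη => ?_)
  have hσ0 := traceNorm_nonneg σ
  obtain ⟨ε, ⟨hε, hεη⟩, hsupport⟩ := exists_supportProj_add_smul_eq (hherm X hX) (hherm σ hσ)
    (hsupp X hX) (δ := η / (2 * traceNorm σ + 1)) (by positivity)
  have hY : X + ε • σ ∈ V := add_mem hX (V.smul_mem ε hσ)
  have hsign := signOp_mem_correctableAlgebra hK (hherm _ hY) (hiso _ hY)
  rw [hsupport] at hsign
  have hYiso : traceNorm (e (X + ε • σ)) = traceNorm (X + ε • σ) :=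
    traceNorm_conditionalExpectation_of_signOp_mem (hherm _ hY) hsign
  have heY : traceNorm (e (X + ε • σ)) ≤ traceNorm (e X) + ε * traceNorm σ := by
    rw [map_add]
    refine (traceNorm_add_le (isHermitian_conditionalExpectation (hherm X hX))
      (isHermitian_conditionalExpectation (hherm _ (V.smul_mem ε hσ)))).trans ?_
    gcongr
    refine (traceNorm_conditionalExpectation_le (hherm _ (V.smul_mem ε hσ))).trans_eq ?_
    rw [traceNorm_smul, abs_of_pos hε]
  have hX' : traceNorm X ≤ traceNorm (X + ε • σ) + ε * traceNorm σ := by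
    have := traceNorm_add_le (hherm _ hY) (hherm _ (V.smul_mem (-ε) hσ))
    rwa [neg_smul, add_neg_cancel_right, traceNorm_neg, traceNorm_smul, abs_of_pos hε] at this
  rw [lt_div_iff₀ (by positivity)] at hεη
  linarith

end Span

section Lifting

variable {n : Type*} [Fintype n] [DecidableEq n] {A : StarSubalgebra ℂ (Matrix n n ℂ)}

lemma mul_eq_zero_of_conditionalExpectation_mul_eq_zero {X B : Matrix n n ℂ} (hX : 0 ≤ X)
    (hB : 0 ≤ B) (hBA : B ∈ A) (h : conditionalExpectation A X * B = 0) : X * B = 0 := by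
  refine mul_eq_zero_of_re_trace_eq_zero hX hB ?_
  rw [Matrix.trace_mul_comm, ← trace_mul_conditionalExpectation hBA, Matrix.trace_mul_comm, h,
    Matrix.trace_zero, Complex.zero_re]

/-- Positivity confines `v` to the range of `W` and `w` to its kernel. -/
lemma add_mul_eq_of_conditionalExpectation_eq {v w W : Matrix n n ℂ} (hv : 0 ≤ v) (hw : 0 ≤ w)
    (hW : IsStarProjection W) (hvW : conditionalExpectation A v = W)
    (hwW : conditionalExpectation A w * W = 0) : (v + w) * W = v := by
  have hWA : W ∈ A := hvW ▸ conditionalExpectation_mem A v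
  have hv0 : v * (1 - W) = 0 := mul_eq_zero_of_conditionalExpectation_mul_eq_zero hv
    hW.one_sub.nonneg (sub_mem (one_mem A) hWA)
    (by rw [hvW, mul_sub, mul_one, hW.isIdempotentElem.eq, sub_self])
  have hw0 : w * W = 0 := mul_eq_zero_of_conditionalExpectation_mul_eq_zero hw hW.nonneg hWA hwW
  rw [mul_sub, mul_one, sub_eq_zero] at hv0
  rw [add_mul, hw0, add_zero, ← hv0]

variable {V : Submodule ℝ (Matrix n n ℂ)} {P : Matrix n n ℂ}

lemma mul_mem_and_commute_of_isStarProjection (hP : IsStarProjection P) (hPA : P ∈ A)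
    (hinj : Set.InjOn (conditionalExpectation A) V)
    (hlift : ∀ W ∈ A, IsStarProjection W → W * P = W →
      ∃ v ∈ V, 0 ≤ v ∧ conditionalExpectation A v = W)
    {D W : Matrix n n ℂ} (hDV : D ∈ V) (hD : 0 ≤ D) (hDP : conditionalExpectation A D = P)
    (hWA : W ∈ A) (hW : IsStarProjection W) (hWP : W * P = W) : D * W ∈ V ∧ Commute D W := by
  have hPW := mul_eq_self_of_mul_eq_self hW.isSelfAdjoint hP.isSelfAdjoint hWP
  obtain ⟨v, hvV, hv, hvW⟩ := hlift W hWA hW hWP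
  obtain ⟨w, hwV, hw, hwW⟩ := hlift (P - W) (sub_mem hPA hWA)
    (hW.sub_of_mul_eq_left hP hWP)
    (by rw [sub_mul, hP.isIdempotentElem.eq, hWP])
  have hsum : v + w = D := hinj (add_mem hvV hwV) hDV (by
    rw [map_add, hvW, hwW, hDP, add_sub_cancel])
  have hDW : D * W = v := by
    rw [← hsum]
    refine add_mul_eq_of_conditionalExpectation_eq hv hw hW hvW ?_
    rw [hwW, sub_mul, hPW, hW.isIdempotentElem.eq, sub_self]
  refine ⟨hDW ▸ hvV, hDW.trans ?_⟩
  simpa only [star_mul, hv.isSelfAdjoint.star_eq, hD.isSelfAdjoint.star_eq,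
    hW.isSelfAdjoint.star_eq] using (congrArg star hDW).symm

/-- The lift `D` of `P` acts as a density: lifting from `A` to `V` is multiplication by `D`. -/
lemma exists_forall_eq_mul_conditionalExpectation (hP : IsStarProjection P) (hPA : P ∈ A)
    (hinj : Set.InjOn (conditionalExpectation A) V)
    (hlift : ∀ W ∈ A, IsStarProjection W → W * P = W →
      ∃ v ∈ V, 0 ≤ v ∧ conditionalExpectation A v = W) :
    ∃ D ∈ V, 0 ≤ D ∧ ∀ X ∈ V, X.IsHermitian →
      conditionalExpectation A X * P = conditionalExpectation A X →
      X = D * conditionalExpectation A X ∧ Commute D (conditionalExpectation A X) := by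
  obtain ⟨D, hDV, hD, hDP⟩ := hlift P hPA hP hP.isIdempotentElem
  refine ⟨D, hDV, hD, fun X hXV hX hXP => ?_⟩
  set a := conditionalExpectation A X
  have ha : a.IsHermitian := isHermitian_conditionalExpectation hX
  have haA : a ∈ A := conditionalExpectation_mem A X
  obtain ⟨hDaV, hcomm⟩ : D * a ∈ V ∧ a ∈ Subalgebra.centralizer ℝ {D} := by
    change a ∈ V.comap (LinearMap.mulLeft ℝ D) ⊓ (Subalgebra.centralizer ℝ {D}).toSubmodule
    refine mem_of_forall_spectralProj_mem ha fun x hx => ?_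
    have hWP : spectralProj {x} a * P = spectralProj {x} a :=
      cfc_mul_eq_self (by simp [hx.symm]) ha hXP
    obtain ⟨hmem, hcomm⟩ := mul_mem_and_commute_of_isStarProjection hP hPA hinj hlift hDV hD hDP
      (cfc_mem_of_mem haA _) (isStarProjection_spectralProj _ a) hWP
    exact ⟨hmem, by rintro _ rfl; exact hcomm.eq⟩
  refine ⟨hinj hXV hDaV ?_, hcomm D rfl⟩
  rw [conditionalExpectation_mul haA, hDP,
    mul_eq_self_of_mul_eq_self ha.isSelfAdjoint hP.isSelfAdjoint hXP]

end Lifting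

section Recovery

variable {n m ι : Type*} [Fintype n] [DecidableEq n] [Fintype m] [Fintype ι]

variable {M : ι → Matrix m n ℂ} {a : Matrix n n ℂ}

lemma krausMap_mul_eq_of_commute (ha : ∀ i j, Commute ((M i)ᴴ * M j) a) (i : ι) :
    krausMap M a * M i = krausMap M 1 * M i * a := by
  simp only [krausMap_apply, Matrix.sum_mul]
  refine Finset.sum_congr rfl fun j _ => ?_
  calc M j * a * (M j)ᴴ * M i = M j * (a * ((M j)ᴴ * M i)) := by simp only [Matrix.mul_assoc]
    _ = M j * (1 : Matrix n n ℂ) * (M j)ᴴ * M i * a := by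
      rw [← (ha j i).eq, Matrix.mul_one]
      simp only [Matrix.mul_assoc]

lemma commute_krausMap_one (ha : ∀ i j, Commute ((M i)ᴴ * M j) a) :
    Commute (krausMap M 1) (krausMap M a) := by
  refine Eq.symm ?_
  calc krausMap M a * krausMap M 1 = ∑ i, krausMap M a * M i * (M i)ᴴ := by
        simp only [krausMap_apply M 1, Matrix.mul_sum, Matrix.mul_one, Matrix.mul_assoc]
    _ = ∑ i, krausMap M 1 * (M i * a * (M i)ᴴ) := by
        simp only [krausMap_mul_eq_of_commute ha, Matrix.mul_assoc]
    _ = krausMap M 1 * krausMap M a := by rw [← Matrix.mul_sum, ← krausMap_apply]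

variable [DecidableEq m]

/-- Outside the range of `S` the completed channel measures in the standard basis and prepares a
fixed pure state. -/
lemma exists_isCPTP_eq_krausMap {n m ι : Type*} [Fintype n] [Nonempty n] [Fintype m] [Fintype ι]
    {T : ι → Matrix n m ℂ} {S : Matrix m m ℂ} (hS : IsStarProjection S)
    (hT : ∑ i, (T i)ᴴ * T i = S) :
    ∃ R : Matrix m m ℂ →ₗ[ℂ] Matrix n n ℂ, IsCPTP R ∧ ∀ Y, S * Y = Y → R Y = krausMap T Y := by
  classical
  obtain ⟨o⟩ := ‹Nonempty n›
  let L : m → Matrix n m ℂ := fun b => Matrix.single o b (1 : ℂ) * (1 - S)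
  have hL : ∑ b, (L b)ᴴ * L b = 1 - S := by
    have hterm : ∀ b, (L b)ᴴ * L b = (1 - S) * (Matrix.single b b (1 : ℂ) * (1 - S)) := fun b => by
      simp only [L, Matrix.conjTranspose_mul, Matrix.conjTranspose_single, star_one,
        hS.one_sub.isSelfAdjoint.isHermitian.eq]
      rw [Matrix.mul_assoc, ← Matrix.mul_assoc (Matrix.single b o (1 : ℂ)),
        Matrix.single_mul_single_same, one_mul]
    simp only [hterm]
    rw [← Finset.mul_sum, ← Finset.sum_mul, Matrix.sum_single_one, one_mul,
      hS.one_sub.isIdempotentElem.eq]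
  refine ⟨krausMap (Sum.elim T L), isCPTP_krausMap ?_, fun Y hY => ?_⟩
  · simp only [Fintype.sum_sum_type, Sum.elim_inl, Sum.elim_inr]
    rw [hT, hL, add_sub_cancel]
  · have hLY : ∀ b, L b * Y = 0 := fun b => by
      rw [Matrix.mul_assoc, sub_mul, one_mul, hY, sub_self, Matrix.mul_zero]
    simp [krausMap_apply, hLY]

lemma supportProj_krausMap_one_mul (M : ι → Matrix m n ℂ) (i : ι) :
    supportProj (krausMap M 1) * M i = M i := by
  set F := krausMap M 1
  set S := supportProj F
  have hS : Sᴴ = S := (isStarProjection_supportProj F).isSelfAdjoint.isHermitian.eq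
  have hF : F.IsHermitian := isHermitian_krausMap M Matrix.isHermitian_one
  have hnonneg : ∀ j, 0 ≤ M j * (1 : Matrix n n ℂ) * (M j)ᴴ := fun j =>
    (Matrix.PosSemidef.one.mul_mul_conjTranspose_same (M j)).nonneg
  have hle : M i * (1 : Matrix n n ℂ) * (M i)ᴴ ≤ F :=
    Finset.single_le_sum (fun j _ => hnonneg j) (Finset.mem_univ i)
  have hzero : M i * (1 : Matrix n n ℂ) * (M i)ᴴ * (1 - S) = 0 :=
    mul_eq_zero_of_add_mul_eq_zero (hnonneg i) (sub_nonneg.mpr hle)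
      (by rw [add_sub_cancel, mul_sub, mul_one, mul_supportProj hF, sub_self])
  rw [Matrix.mul_one, Matrix.self_mul_conjTranspose_mul_eq_zero, Matrix.mul_sub, Matrix.mul_one,
    sub_eq_zero] at hzero
  simpa [hS] using (congrArg Matrix.conjTranspose hzero).symm

lemma cfc_inv_sqrt_mul_mul_cfc_inv_sqrt {F : Matrix n n ℂ} (hF : 0 ≤ F) :
    cfc (fun x => (√x)⁻¹) F * F * cfc (fun x => (√x)⁻¹) F = supportProj F := by
  rw [cfc_mul_self hF.isSelfAdjoint.isHermitian, cfc_mul_cfc, supportProj, spectralProj]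
  refine cfc_congr fun x hx => ?_
  rcases (spectrum_nonneg_of_nonneg hF hx).eq_or_lt with rfl | hx
  · simp
  · have := Real.mul_self_sqrt hx.le
    have hs := (Real.sqrt_pos.mpr hx).ne'
    simp only [Set.mem_compl_iff, Set.mem_singleton_iff, hx.ne', not_false_eq_true,
      Set.indicator_of_mem, Pi.one_apply]
    field_simp
    rw [sq, this]

/-- The Petz recovery map, with Kraus operators `(M i)ᴴ * F⁻¹ᐟ²` where `F = krausMap M 1`. -/
lemma exists_isCPTP_recovery {n m ι : Type*} [Fintype n] [Nonempty n] [Fintype m] [Fintype ι]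
    (M : ι → Matrix m n ℂ) :
    ∃ R : Matrix m m ℂ →ₗ[ℂ] Matrix n n ℂ, IsCPTP R ∧
      ∀ a, (∀ i j, Commute ((M i)ᴴ * M j) a) → R (krausMap M a) = (∑ i, (M i)ᴴ * M i) * a := by
  classical
  set F := krausMap M 1
  set S := supportProj F
  set G := cfc (fun x => (√x)⁻¹) F
  have hF : 0 ≤ F := krausMap_nonneg M zero_le_one
  have hG : Gᴴ = G := isHermitian_cfc _ F
  have hGFG : G * F * G = S := cfc_inv_sqrt_mul_mul_cfc_inv_sqrt hF
  have hFG : Commute F G := (Commute.cfc_real (Commute.refl F) _).symm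
  have hsum : ∑ i, ((M i)ᴴ * G)ᴴ * ((M i)ᴴ * G) = S := calc
    _ = G * F * G := by
      simp [F, krausMap_apply, Matrix.mul_sum, Matrix.sum_mul, Matrix.mul_assoc, hG]
    _ = S := hGFG
  obtain ⟨R, hR, hRY⟩ := exists_isCPTP_eq_krausMap (isStarProjection_supportProj F) hsum
  refine ⟨R, hR, fun a ha => ?_⟩
  have hSY : S * krausMap M a = krausMap M a := by
    simp only [krausMap_apply M a, Finset.mul_sum, ← Matrix.mul_assoc, S, F,
      supportProj_krausMap_one_mul]
  have hGY : Commute G (krausMap M a) := (commute_krausMap_one ha).cfc_real _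
  have hGYGM : ∀ i, G * krausMap M a * G * M i = M i * a := fun i => calc
    G * krausMap M a * G * M i = G * G * (krausMap M a * M i) := by
      rw [mul_assoc G, ← hGY.eq]; simp only [Matrix.mul_assoc]
    _ = G * (F * G) * M i * a := by
      rw [krausMap_mul_eq_of_commute ha, hFG.eq]; simp only [F, Matrix.mul_assoc]
    _ = M i * a := by rw [← mul_assoc, hGFG, supportProj_krausMap_one_mul]
  rw [hRY _ hSY, krausMap_apply, Finset.sum_mul]
  refine Finset.sum_congr rfl fun i _ => ?_
  calc (M i)ᴴ * G * krausMap M a * ((M i)ᴴ * G)ᴴ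
      = (M i)ᴴ * (G * krausMap M a * G * M i) := by simp [hG, Matrix.mul_assoc]
    _ = (M i)ᴴ * M i * a := by rw [hGYGM, Matrix.mul_assoc]

lemma exists_isCPTP_recovery_density {n m ι : Type*} [Fintype n] [DecidableEq n] [Nonempty n]
    [Fintype m] [Fintype ι] {K : ι → Matrix m n ℂ} (hK : ∑ r, (K r)ᴴ * K r = 1)
    {P D : Matrix n n ℂ} (hP : P.IsHermitian) (hD : 0 ≤ D) (hDP : D * P = D) :
    ∃ R : Matrix m m ℂ →ₗ[ℂ] Matrix n n ℂ, IsCPTP R ∧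
      ∀ a ∈ correctableAlgebra K P, Commute D a → R (krausMap K (D * a)) = D * a := by
  set Q := cfc Real.sqrt D
  have hDH : D.IsHermitian := hD.isSelfAdjoint.isHermitian
  have hQ : Qᴴ = Q := isHermitian_cfc _ D
  have hQP : Q * P = Q := cfc_mul_eq_self Real.sqrt_zero hDH hDP
  have hPQ : P * Q = Q := mul_eq_self_of_mul_eq_self hQ hP.isSelfAdjoint hQP
  have hQQ : Q * Q = D := by
    rw [cfc_mul_cfc]
    conv_rhs => rw [← cfc_id' ℝ D hDH.isSelfAdjoint]
    exact cfc_congr fun x hx => Real.mul_self_sqrt (spectrum_nonneg_of_nonneg hD hx)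
  obtain ⟨R, hR, hRa⟩ := exists_isCPTP_recovery fun i => K i * Q
  refine ⟨R, hR, fun a ha hDa => ?_⟩
  have hQa : Commute Q a := hDa.cfc_real _
  have hprod : ∀ i j, (K i * Q)ᴴ * (K j * Q) = Q * (P * ((K i)ᴴ * K j) * P) * Q := fun i j => by
    calc (K i * Q)ᴴ * (K j * Q) = Q * ((K i)ᴴ * K j) * Q := by simp [hQ, Matrix.mul_assoc]
      _ = Q * P * ((K i)ᴴ * K j) * (P * Q) := by rw [hQP, hPQ]
      _ = Q * (P * ((K i)ᴴ * K j) * P) * Q := by simp only [Matrix.mul_assoc]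
  have hkraus : krausMap (fun i => K i * Q) a = krausMap K (D * a) := by
    rw [← hQQ, mul_assoc, hQa.eq]
    simp [krausMap_apply, hQ, Matrix.mul_assoc]
  have hsum : ∑ i, (K i * Q)ᴴ * (K i * Q) = D := calc
    _ = Q * (∑ i, (K i)ᴴ * K i) * Q := by
      simp [hQ, Finset.mul_sum, Finset.sum_mul, Matrix.mul_assoc]
    _ = D := by rw [hK, mul_one, hQQ]
  rw [← hkraus, hRa a fun i j => ?_, hsum]
  rw [hprod]
  exact (hQa.mul_left (((mem_correctableAlgebra hP).mp ha).2 i j)).mul_left hQa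

end Recovery

section StateSpace

variable {n : Type*} [Fintype n] {W : Matrix n n ℂ}

lemma re_trace_pos (hW : 0 ≤ W) (hW0 : W ≠ 0) : 0 < W.trace.re := by
  have hpos := Matrix.nonneg_iff_posSemidef.mp hW
  exact (Complex.pos_iff.mp
    (hpos.trace_nonneg.lt_of_ne' (mt hpos.trace_eq_zero_iff.mp hW0))).1

lemma inv_re_trace_smul_mem_stateSpace (hW : 0 ≤ W) (htrace : 0 < W.trace.re) :
    W.trace.re⁻¹ • W ∈ stateSpace n := by
  have hpos := Matrix.nonneg_iff_posSemidef.mp hW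
  refine ⟨hpos.smul (inv_nonneg.mpr htrace.le), ?_⟩
  rw [Matrix.trace_smul, ← Complex.re_add_im W.trace, ← (Complex.le_def.mp hpos.trace_nonneg).2]
  simp [htrace.ne']

end StateSpace

section Isometry

variable {n m : Type*} [Fintype n] [DecidableEq n] [Fintype m] [DecidableEq m]
  {e : Matrix n n ℂ →ₗ[ℂ] Matrix m m ℂ} {C : Set (Matrix n n ℂ)}

lemma injOn_span_of_traceNorm_map
    (hiso : ∀ X ∈ Submodule.span ℝ C, traceNorm (e X) = traceNorm X) :
    Set.InjOn e (Submodule.span ℝ C) := fun X hX Y hY hXY => by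
  have hmem := sub_mem hX hY
  refine sub_eq_zero.mp (eq_zero_of_traceNorm_eq_zero ?_)
  rw [← hiso _ hmem, map_sub, hXY, sub_self]
  simp [traceNorm]

lemma isIsometric_image (hiso : ∀ X ∈ Submodule.span ℝ C, traceNorm (e X) = traceNorm X) :
    IsIsometric C (e '' C) := by
  refine ⟨e.restrictScalars ℝ, ((injOn_span_of_traceNorm_map hiso).mono
    Submodule.subset_span).bijOn_image, fun ρ hρ σ hσ p _ => ?_⟩
  have hV := convexHull_subset_span C
  rw [← map_smul, ← map_smul, ← map_sub]
  exact hiso _ (sub_mem (Submodule.smul_mem _ p (hV hρ)) (Submodule.smul_mem _ (1 - p) (hV hσ)))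

end Isometry

section Code

variable {n m ι : Type*} [Fintype n] [DecidableEq n] [Fintype m]

/-- The states supported on `P` that lie in the correctable algebra. This code is preserved by
`krausMap K`, and `conditionalExpectation` maps a maximum preserved code onto it. -/
def correctableCode (K : ι → Matrix m n ℂ) (P : Matrix n n ℂ) : Set (Matrix n n ℂ) :=
  {ρ ∈ stateSpace n | ρ ∈ correctableAlgebra K P ∧ ρ * P = ρ}

lemma real_smul_mem {A : StarSubalgebra ℂ (Matrix n n ℂ)} {X : Matrix n n ℂ} (hX : X ∈ A)
    (c : ℝ) : c • X ∈ A := by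
  rw [← Complex.coe_smul]
  exact A.smul_mem hX _

lemma convex_correctableCode (K : ι → Matrix m n ℂ) (P : Matrix n n ℂ) :
    Convex ℝ (correctableCode K P) := by
  rintro ρ ⟨hρ, hρA, hρP⟩ σ ⟨hσ, hσA, hσP⟩ a b ha hb hab
  refine ⟨convex_stateSpace n hρ hσ ha hb hab,
    add_mem (real_smul_mem hρA a) (real_smul_mem hσA b), ?_⟩
  rw [add_mul, smul_mul_assoc, smul_mul_assoc, hρP, hσP]

lemma exists_mem_span_conditionalExpectation_eq {K : ι → Matrix m n ℂ} {P W : Matrix n n ℂ}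
    {C : Set (Matrix n n ℂ)} (hC : C ⊆ stateSpace n)
    (himage : correctableCode K P ⊆ conditionalExpectation (correctableAlgebra K P) '' C)
    (hW : 0 ≤ W) (hWA : W ∈ correctableAlgebra K P) (hWP : W * P = W) :
    ∃ v ∈ Submodule.span ℝ C, 0 ≤ v ∧ conditionalExpectation (correctableAlgebra K P) v = W := by
  rcases eq_or_ne W 0 with rfl | hW0
  · exact ⟨0, zero_mem _, le_rfl, map_zero _⟩
  have htrace := re_trace_pos hW hW0
  obtain ⟨ρ, hρ, hρW⟩ := himage ⟨inv_re_trace_smul_mem_stateSpace hW htrace,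
    real_smul_mem hWA _, by rw [smul_mul_assoc, hWP]⟩
  refine ⟨W.trace.re • ρ, Submodule.smul_mem _ _ (Submodule.subset_span hρ),
    smul_nonneg htrace.le (hC hρ).1.nonneg, ?_⟩
  rw [LinearMap.map_smul_of_tower, hρW, smul_inv_smul₀ htrace.ne']

lemma image_conditionalExpectation_subset_correctableCode {K : ι → Matrix m n ℂ}
    {P : Matrix n n ℂ} (hP : IsStarProjection P) {C : Set (Matrix n n ℂ)} (hC : C ⊆ stateSpace n)
    (hCP : ∀ ρ ∈ C, ρ * P = ρ) :
    conditionalExpectation (correctableAlgebra K P) '' C ⊆ correctableCode K P := by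
  rintro _ ⟨ρ, hρ, rfl⟩
  refine ⟨⟨?_, ?_⟩, conditionalExpectation_mem _ ρ, ?_⟩
  · exact Matrix.nonneg_iff_posSemidef.mp (conditionalExpectation_nonneg (hC hρ).1.nonneg)
  · rw [trace_conditionalExpectation, (hC hρ).2]
  · rw [← conditionalExpectation_mul (mem_correctableAlgebra_self hP), hCP ρ hρ]

variable [Fintype ι] [DecidableEq m] {K : ι → Matrix m n ℂ} {P : Matrix n n ℂ}
  {C : Set (Matrix n n ℂ)}

lemma isPreserved_correctableCode (hK : ∑ r, (K r)ᴴ * K r = 1) (hP : P.IsHermitian) :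
    IsPreserved (krausMap K) (correctableCode K P) := by
  refine ⟨fun ρ hρ => hρ.1, fun ρ hρ σ hσ p _ => ?_⟩
  rw [(convex_correctableCode K P).convexHull_eq] at hρ hσ
  obtain ⟨hρ, hρA, hρP⟩ := hρ
  obtain ⟨hσ, hσA, hσP⟩ := hσ
  refine traceNorm_krausMap_of_mem_correctableAlgebra hK hP
    (isHermitian_smul_sub_smul hρ.1.isHermitian hσ.1.isHermitian p (1 - p))
    (sub_mem (real_smul_mem hρA p) (real_smul_mem hσA (1 - p))) ?_
  rw [sub_mul, smul_mul_assoc, smul_mul_assoc, hρP, hσP]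

lemma IsMaximumPreserved.image_conditionalExpectation_eq (hK : ∑ r, (K r)ᴴ * K r = 1)
    (hP : IsStarProjection P) (hC : IsMaximumPreserved (krausMap K) C)
    (hCP : ∀ ρ ∈ C, ρ * P = ρ)
    (hiso : ∀ X ∈ Submodule.span ℝ C,
      traceNorm (conditionalExpectation (correctableAlgebra K P) X) = traceNorm X) :
    conditionalExpectation (correctableAlgebra K P) '' C = correctableCode K P := by
  by_contra hne
  have hsub := image_conditionalExpectation_subset_correctableCode (K := K) hP hC.1.1 hCP
  exact hC.2 ⟨_, _, isPreserved_correctableCode hK hP.isSelfAdjoint.isHermitian,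
    hsub.ssubset_of_ne hne, isIsometric_image hiso⟩

end Code

section Recoverability

variable {n m ι : Type*} [Fintype n] [DecidableEq n] [Fintype m] [DecidableEq m] [Fintype ι]
  {K : ι → Matrix m n ℂ} {C : Set (Matrix n n ℂ)}

lemma IsPreserved.exists_isStarProjection (hK : ∑ r, (K r)ᴴ * K r = 1)
    (hC : IsPreserved (krausMap K) C) (hne : C.Nonempty) :
    ∃ P, IsStarProjection P ∧ ∀ X ∈ Submodule.span ℝ C, X * P = X ∧
      traceNorm (conditionalExpectation (correctableAlgebra K P) X) = traceNorm X := by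
  have hstate := convexHull_min hC.1 (convex_stateSpace n)
  obtain ⟨σ, hσ, hσC⟩ := exists_forall_mul_supportProj_eq (convex_convexHull ℝ C)
    hne.convexHull fun ρ hρ => (hstate hρ).1.nonneg
  set P := supportProj σ
  have hsupp : ∀ X ∈ Submodule.span ℝ C, X * P = X := fun X hX =>
    (Submodule.span_le (p := LinearMap.eqLocus (LinearMap.mulRight ℝ P) LinearMap.id)).mpr
      (fun ρ hρ => hσC ρ (subset_convexHull ℝ C hρ)) hX
  exact ⟨P, isStarProjection_supportProj σ, fun X hX => ⟨hsupp X hX,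
    traceNorm_conditionalExpectation_correctableAlgebra hK
      (fun Y hY => isHermitian_of_mem_span hC.1 hY)
      (fun Y hY => hC.traceNorm_map_of_mem_span hne hY)
      (convexHull_subset_span C hσ) hsupp hX⟩⟩

theorem IsMaximumPreserved.exists_isFixed [Nonempty n] {E : Matrix n n ℂ →ₗ[ℂ] Matrix m m ℂ}
    (hE : IsCPTP E) (hC : IsMaximumPreserved E C) :
    ∃ R : Matrix m m ℂ →ₗ[ℂ] Matrix n n ℂ, IsCPTP R ∧ IsFixed (R ∘ₗ E) C := by
  obtain ⟨K, rfl, hK⟩ := hE.exists_eq_krausMap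
  rcases C.eq_empty_or_nonempty with rfl | hne
  · obtain ⟨R, hR, -⟩ := exists_isCPTP_recovery K
    exact ⟨R, hR, fun ρ hρ => hρ.elim⟩
  obtain ⟨P, hP, hV⟩ := hC.1.exists_isStarProjection hK hne
  have hsupp := fun X hX => (hV X hX).1
  have hiso := fun X hX => (hV X hX).2
  have himage := hC.image_conditionalExpectation_eq hK hP
    (fun ρ hρ => hsupp ρ (Submodule.subset_span hρ)) hiso
  obtain ⟨D, hDV, hD, hlift⟩ := exists_forall_eq_mul_conditionalExpectation hP
    (mem_correctableAlgebra_self hP) (injOn_span_of_traceNorm_map hiso)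
    fun W hWA hW hWP => exists_mem_span_conditionalExpectation_eq hC.1.1 himage.ge hW.nonneg hWA hWP
  obtain ⟨R, hR, hrecover⟩ := exists_isCPTP_recovery_density hK hP.isSelfAdjoint.isHermitian hD
    (hsupp D hDV)
  refine ⟨R, hR, fun ρ hρ => ?_⟩
  have hρV := Submodule.subset_span (R := ℝ) hρ
  obtain ⟨hρD, hcomm⟩ := hlift ρ hρV (hC.1.1 hρ).1.isHermitian
    ((image_conditionalExpectation_subset_correctableCode hP hC.1.1
      (fun τ hτ => hsupp τ (Submodule.subset_span hτ)) ⟨ρ, hρ, rfl⟩).2.2)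
  have hfixed := hrecover _ (conditionalExpectation_mem _ ρ) hcomm
  rwa [← hρD] at hfixed

end Recoverability

end QuantumCode

end

theorem mainTheorem3 {n m : Type*} [Fintype n] [DecidableEq n] [Nonempty n]
    [Fintype m] [DecidableEq m]
    (E : Matrix n n ℂ →ₗ[ℂ] Matrix m m ℂ) (hE : QuantumCode.IsCPTP E) :
    (∀ C : Set (Matrix n n ℂ), QuantumCode.IsMaximumPreserved E C →
      ∃ R : Matrix m m ℂ →ₗ[ℂ] Matrix n n ℂ,
        QuantumCode.IsCPTP R ∧ QuantumCode.IsFixed (R ∘ₗ E) C) ∧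
    (∀ C : Set (Matrix n n ℂ), C ⊆ QuantumCode.stateSpace n →
      (∃ R : Matrix m m ℂ →ₗ[ℂ] Matrix n n ℂ,
        QuantumCode.IsCPTP R ∧ QuantumCode.IsFixed (R ∘ₗ E) C) →
      QuantumCode.IsPreserved E C) :=
  ⟨fun _ hC => hC.exists_isFixed hE,
    fun _ hC ⟨_, hR, hRE⟩ => QuantumCode.isPreserved_of_isFixed hE hC hR hRE⟩
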